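/- Consider classical first-order logic over an arbitrary signature of relation, constant and function symbols, with the logical constants $\top$ and $\bot$ available as formulas and with models having nonempty domains. For a formula $\chi$ let $\mathrm{sig}(\chi)$ be the set of relation, constant and function symbols occurring in $\chi$. Call $\chi$ function-free if no function symbol of positive arity occurs in it (constant symbols are allowed), and equality-free if no equation $t_1=t_2$ occurs in it. Theorem (Craig interpolation). For all function-free, equality-free first-order sentences $\varphi,\psi$, if $\{\varphi,\psi\}$ is unsatisfiable, then there is a function-free, equality-free first-order sentence $\theta$ such that $\models\varphi\to\theta$, $\models\psi\to\neg\theta$ and $\mathrm{sig}(\theta)\subseteq\mathrm{sig}(\varphi)\cap\mathrm{sig}(\psi)$. -/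

import Mathlib

open FirstOrder

universe u v w

namespace FirstOrder.Language

variable {L : Language.{u, v}} {α : Type w}

/-- The signature of a term: the set of constant and function symbols occurring in it
(constant symbols are the function symbols of arity `0`). -/
def Term.sig : L.Term α → Set L.Symbols
  | .var _ => ∅
  | .func f ts => insert (Sum.inl ⟨_, f⟩) (⋃ i, (ts i).sig)

/-- The signature of a formula: the set of relation, constant and function symbols occurring
in it. -/
def BoundedFormula.sig : ∀ {n : ℕ}, L.BoundedFormula α n → Set L.Symbols
  | _, .falsum => ∅
  | _, .equal t₁ t₂ => t₁.sig ∪ t₂.sig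
  | _, .rel R ts => insert (Sum.inr ⟨_, R⟩) (⋃ i, (ts i).sig)
  | _, .imp φ ψ => φ.sig ∪ ψ.sig
  | _, .all φ => φ.sig

/-- A formula is function-free if no function symbol of positive arity occurs in it;
constant symbols are allowed. -/
def BoundedFormula.FunctionFree {n : ℕ} (φ : L.BoundedFormula α n) : Prop :=
  ∀ (l : ℕ) (f : L.Functions l), Sum.inl ⟨l, f⟩ ∈ φ.sig → l = 0

/-- A formula is equality-free if no equation `t₁ = t₂` occurs in it. -/
def BoundedFormula.EqualityFree : ∀ {n : ℕ}, L.BoundedFormula α n → Prop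
  | _, .falsum => True
  | _, .equal _ _ => False
  | _, .rel _ _ => True
  | _, .imp φ ψ => φ.EqualityFree ∧ ψ.EqualityFree
  | _, .all φ => φ.EqualityFree

end FirstOrder.Language

/-! Interpolation is proved by a Henkin construction on pairs. Constants are read as parameters in a
countable set `P` with infinitely many spare elements. Two sets of signed instances are separable if
a formula over the common relation symbols, with free variables among the common parameters, follows
from one and is refuted by the other. If `φ` and `ψ` cannot be separated, their pair can be enlarged
while staying inseparable (`Inseparable.exists_decides`) until each side decides every instance of
its subformulas and has its witnesses (`exists_isHintikka`).

Since there is no equality, `P` itself, without a quotient, is the domain of a common model of both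
sentences. An atom affirmed on one side and denied on the other would itself be a separator
(`IsHintikka.not_termRel`); the remaining cases are the truth lemma `IsHintikka.holds_termRel`.
Unsatisfiability therefore yields a separator, and replacing parameters by constants again gives the
interpolant. -/

namespace FirstOrder.Language

open Function Set

variable {L : Language.{u, v}} {P : Type*} {M : Type*}

/-! ### Subformulas and countability of signatures -/

namespace BoundedFormula

/-- The subformulas of a formula. -/
def subformulas : ∀ {n : ℕ}, L.BoundedFormula Empty n → Set (Σ n, L.BoundedFormula Empty n)
  | n, .falsum => {⟨n, .falsum⟩}
  | n, .equal t₁ t₂ => {⟨n, .equal t₁ t₂⟩}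
  | n, .rel R ts => {⟨n, .rel R ts⟩}
  | n, .imp φ ψ => insert ⟨n, .imp φ ψ⟩ (φ.subformulas ∪ ψ.subformulas)
  | n, .all φ => insert ⟨n, .all φ⟩ φ.subformulas

theorem self_mem_subformulas {n : ℕ} (φ : L.BoundedFormula Empty n) :
    (⟨n, φ⟩ : Σ n, L.BoundedFormula Empty n) ∈ φ.subformulas := by
  cases φ <;> simp [subformulas]

theorem countable_subformulas {n : ℕ} (φ : L.BoundedFormula Empty n) :
    φ.subformulas.Countable := by
  induction φ with
  | falsum => exact countable_singleton _
  | equal => exact countable_singleton _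
  | rel => exact countable_singleton _
  | imp _ _ h₁ h₂ => exact (h₁.union h₂).insert _
  | all _ h => exact h.insert _

theorem sig_subset_of_mem_subformulas {n : ℕ} {φ : L.BoundedFormula Empty n}
    {χ : Σ n, L.BoundedFormula Empty n} (h : χ ∈ φ.subformulas) : χ.2.sig ⊆ φ.sig := by
  induction φ with
  | falsum => rw [mem_singleton_iff.1 h]
  | equal => rw [mem_singleton_iff.1 h]
  | rel => rw [mem_singleton_iff.1 h]
  | imp _ _ h₁ h₂ =>
    rcases h with rfl | h | h
    · exact Subset.rfl
    · exact (h₁ h).trans subset_union_left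
    · exact (h₂ h).trans subset_union_right
  | all _ ih =>
    rcases h with rfl | h
    · exact Subset.rfl
    · exact ih h

theorem subformulas_subset_of_mem {n : ℕ} {φ : L.BoundedFormula Empty n}
    {χ : Σ n, L.BoundedFormula Empty n} (h : χ ∈ φ.subformulas) :
    χ.2.subformulas ⊆ φ.subformulas := by
  induction φ with
  | falsum => rw [mem_singleton_iff.1 h]
  | equal => rw [mem_singleton_iff.1 h]
  | rel => rw [mem_singleton_iff.1 h]
  | imp _ _ h₁ h₂ =>
    rcases h with rfl | h | h
    · exact Subset.rfl
    · exact (h₁ h).trans (subset_union_left.trans (subset_insert _ _))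
    · exact (h₂ h).trans (subset_union_right.trans (subset_insert _ _))
  | all _ ih =>
    rcases h with rfl | h
    · exact Subset.rfl
    · exact (ih h).trans (subset_insert _ _)

theorem countable_functions_sig_term {α : Type*} (t : L.Term α) :
    {f : Σ n, L.Functions n | Sum.inl f ∈ t.sig}.Countable := by
  induction t with
  | var => simp [Term.sig]
  | func f ts ih =>
    refine ((countable_singleton ⟨_, f⟩).union (countable_iUnion ih)).mono fun g hg => ?_
    rcases hg with hg | hg
    · exact Or.inl (Sum.inl_injective hg)
    · exact Or.inr (by simpa using hg)

theorem countable_functions_sig {α : Type*} {n : ℕ} (φ : L.BoundedFormula α n) :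
    {f : Σ n, L.Functions n | Sum.inl f ∈ φ.sig}.Countable := by
  induction φ with
  | falsum => simp [sig]
  | equal t₁ t₂ =>
    exact (countable_functions_sig_term t₁).union (countable_functions_sig_term t₂)
  | rel R ts =>
    refine (countable_iUnion fun i => countable_functions_sig_term (ts i)).mono fun g hg => ?_
    rcases hg with hg | hg
    · cases hg
    · simpa using hg
  | imp _ _ h₁ h₂ => exact h₁.union h₂
  | all _ ih => exact ih

end BoundedFormula

/-! ### Semantics of function-free, equality-free formulas -/

/-- The value of a function-free term, where `k` assigns values to the function symbols. -/
def Term.value (k : (Σ n, L.Functions n) → M) {n : ℕ} (x : Fin n → M) :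
    L.Term (Empty ⊕ Fin n) → M
  | .var (.inl a) => a.elim
  | .var (.inr i) => x i
  | .func f _ => k ⟨_, f⟩

/-- Truth of a function-free and equality-free formula under an interpretation `r` of the relation
symbols and `k` of the function symbols. -/
def BoundedFormula.Holds (r : ∀ n, L.Relations n → (Fin n → M) → Prop)
    (k : (Σ n, L.Functions n) → M) : ∀ {n : ℕ}, L.BoundedFormula Empty n → (Fin n → M) → Prop
  | _, .falsum, _ => False
  -- A junk value: equality-free formulas never reach this case.
  | _, .equal _ _, _ => False
  | _, .rel R ts, x => r _ R fun i => (ts i).value k x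
  | _, .imp φ ψ, x => φ.Holds r k x → ψ.Holds r k x
  | _, .all φ, x => ∀ a, φ.Holds r k (Fin.snoc x a)

theorem Term.value_congr {k k' : (Σ n, L.Functions n) → M} {n : ℕ} (x : Fin n → M)
    (t : L.Term (Empty ⊕ Fin n)) (h : ∀ f, Sum.inl f ∈ t.sig → k f = k' f) :
    t.value k x = t.value k' x := by
  cases t with
  | var a => rcases a with a | i; exacts [a.elim, rfl]
  | func f ts => exact h _ (mem_insert _ _)

theorem Term.value_comp (e : P → M) (k : (Σ n, L.Functions n) → P) {n : ℕ} (x : Fin n → P)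
    (t : L.Term (Empty ⊕ Fin n)) : t.value (e ∘ k) (e ∘ x) = e (t.value k x) := by
  cases t with
  | var a => rcases a with a | i; exacts [a.elim, rfl]
  | func f ts => rfl

theorem Term.value_mem {A : Set P} {k : (Σ n, L.Functions n) → P} {n : ℕ} {x : Fin n → P}
    {t : L.Term (Empty ⊕ Fin n)} (hk : ∀ f, Sum.inl f ∈ t.sig → k f ∈ A) (hx : ∀ i, x i ∈ A) :
    t.value k x ∈ A := by
  cases t with
  | var a => rcases a with a | i; exacts [a.elim, hx i]
  | func f ts => exact hk _ (mem_insert _ _)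

theorem Term.realize_eq_value [L.Structure M] {k : (Σ n, L.Functions n) → M} {n : ℕ}
    (w : Empty → M) (x : Fin n → M) (t : L.Term (Empty ⊕ Fin n))
    (h0 : ∀ l (f : L.Functions l), Sum.inl ⟨l, f⟩ ∈ t.sig → l = 0)
    (hk : ∀ c : L.Functions 0, Sum.inl ⟨0, c⟩ ∈ t.sig → k ⟨0, c⟩ = Structure.funMap c default) :
    t.realize (Sum.elim w x) = t.value k x := by
  cases t with
  | var a => rcases a with a | i; exacts [a.elim, rfl]
  | @func l f ts =>
    obtain rfl := h0 l f (mem_insert _ _)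
    rw [Term.value, hk f (mem_insert _ _), Term.realize, Subsingleton.elim default]

theorem BoundedFormula.holds_congr {r : ∀ n, L.Relations n → (Fin n → M) → Prop}
    {k k' : (Σ n, L.Functions n) → M} {n : ℕ} (φ : L.BoundedFormula Empty n) (x : Fin n → M)
    (h : ∀ f, Sum.inl f ∈ φ.sig → k f = k' f) : φ.Holds r k x ↔ φ.Holds r k' x := by
  induction φ with
  | falsum => rfl
  | equal => rfl
  | rel R ts =>
    have : ∀ i, (ts i).value k x = (ts i).value k' x := fun i =>
      Term.value_congr _ _ fun f hf => h f (mem_insert_of_mem _ (mem_iUnion_of_mem i hf))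
    simp [Holds, this]
  | imp _ _ h₁ h₂ =>
    exact imp_congr (h₁ x fun f hf => h f (Or.inl hf)) (h₂ x fun f hf => h f (Or.inr hf))
  | all _ ih => exact forall_congr' fun a => ih _ h

theorem BoundedFormula.realize_iff_holds [L.Structure M] {k : (Σ n, L.Functions n) → M} {n : ℕ}
    (φ : L.BoundedFormula Empty n) (w : Empty → M) (x : Fin n → M)
    (hf : φ.FunctionFree) (he : φ.EqualityFree)
    (hk : ∀ c : L.Functions 0, Sum.inl ⟨0, c⟩ ∈ φ.sig → k ⟨0, c⟩ = Structure.funMap c default) :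
    φ.Realize w x ↔ φ.Holds (fun _ => Structure.RelMap) k x := by
  induction φ with
  | falsum => rfl
  | equal => exact he.elim
  | rel R ts =>
    have : ∀ i, (ts i).realize (Sum.elim w x) = (ts i).value k x := fun i =>
      Term.realize_eq_value w x _
        (fun l f h => hf l f (mem_insert_of_mem _ (mem_iUnion_of_mem i h)))
        (fun c h => hk c (mem_insert_of_mem _ (mem_iUnion_of_mem i h)))
    simp [Holds, BoundedFormula.Realize, this]
  | imp _ _ h₁ h₂ =>
    exact imp_congr
      (h₁ x (fun l f h => hf l f (Or.inl h)) he.1 fun c h => hk c (Or.inl h))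
      (h₂ x (fun l f h => hf l f (Or.inr h)) he.2 fun c h => hk c (Or.inr h))
  | all _ ih => exact forall_congr' fun a => ih _ hf he hk

/-! ### Formulas with named variables, in which separators are written -/

/-- Relational equality-free formulas with named variables from `P`. -/
inductive NamedFormula (L : Language.{u, v}) (P : Type*)
  | bot : NamedFormula L P
  | rel {n : ℕ} (R : L.Relations n) (ts : Fin n → P) : NamedFormula L P
  | imp (θ₁ θ₂ : NamedFormula L P) : NamedFormula L P
  | all (p : P) (θ : NamedFormula L P) : NamedFormula L P

namespace NamedFormula

/-- The relation symbols of a named formula. -/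
def rels : NamedFormula L P → Set (Σ n, L.Relations n)
  | bot => ∅
  | rel R _ => {⟨_, R⟩}
  | imp θ₁ θ₂ => θ₁.rels ∪ θ₂.rels
  | all _ θ => θ.rels

/-- The free variables of a named formula. -/
def free : NamedFormula L P → Set P
  | bot => ∅
  | rel _ ts => range ts
  | imp θ₁ θ₂ => θ₁.free ∪ θ₂.free
  | all p θ => θ.free \ {p}

open Classical in
/-- Truth of a named formula. -/
noncomputable def Holds (r : ∀ n, L.Relations n → (Fin n → M) → Prop) :
    NamedFormula L P → (P → M) → Prop
  | bot, _ => False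
  | rel R ts, e => r _ R (e ∘ ts)
  | imp θ₁ θ₂, e => θ₁.Holds r e → θ₂.Holds r e
  | all p θ, e => ∀ a, θ.Holds r (update e p a)

theorem holds_congr {r : ∀ n, L.Relations n → (Fin n → M) → Prop} (θ : NamedFormula L P)
    {e e' : P → M} (h : EqOn e e' θ.free) : θ.Holds r e ↔ θ.Holds r e' := by
  classical
  induction θ generalizing e e' with
  | bot => rfl
  | rel R ts =>
    have : e ∘ ts = e' ∘ ts := funext fun i => h (mem_range_self i)
    simp [Holds, this]
  | imp _ _ h₁ h₂ =>
    exact imp_congr (h₁ (h.mono subset_union_left)) (h₂ (h.mono subset_union_right))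
  | all p θ ih =>
    refine forall_congr' fun a => ih fun q hq => ?_
    by_cases hqp : q = p
    · simp [hqp]
    · simp [hqp, h ⟨hq, hqp⟩]

/-- The term given by a constant symbol or a bound variable. -/
def atomTerm {n : ℕ} : L.Functions 0 ⊕ Fin n → L.Term (Empty ⊕ Fin n)
  | .inl c => .func c default
  | .inr i => .var (.inr i)

open Classical in
/-- Translation of a named formula, where `ρ` says what the variables stand for. -/
noncomputable def toBounded : NamedFormula L P → ∀ {n : ℕ}, (P → L.Functions 0 ⊕ Fin n) →
    L.BoundedFormula Empty n
  | bot, _, _ => .falsum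
  | rel R ts, _, ρ => .rel R fun i => atomTerm (ρ (ts i))
  | imp θ₁ θ₂, _, ρ => .imp (θ₁.toBounded ρ) (θ₂.toBounded ρ)
  | all p θ, n, ρ =>
    .all (θ.toBounded (update (Sum.map id Fin.castSucc ∘ ρ) p (.inr (Fin.last n))))

theorem realize_toBounded [L.Structure M] (θ : NamedFormula L P) {n : ℕ}
    (ρ : P → L.Functions 0 ⊕ Fin n) (w : Empty → M) (x : Fin n → M) :
    (θ.toBounded ρ).Realize w x ↔ θ.Holds (fun _ => Structure.RelMap)
      (fun p => Sum.elim (fun c => Structure.funMap c default) x (ρ p)) := by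
  classical
  induction θ generalizing n with
  | bot => rfl
  | rel R ts =>
    refine iff_of_eq (congrArg (Structure.RelMap R) (funext fun i => ?_))
    simp only [comp_apply]
    cases ρ (ts i) with
    | inl c => simp [atomTerm, Subsingleton.elim _ (default : Fin 0 → M)]
    | inr i => rfl
  | imp _ _ h₁ h₂ => exact imp_congr (h₁ ρ x) (h₂ ρ x)
  | all p θ ih =>
    refine forall_congr' fun a => (ih _ _).trans (iff_of_eq (congrArg _ (funext fun q => ?_)))
    by_cases hq : q = p
    · subst hq; simp
    · simp only [update_of_ne hq, comp_apply]
      cases ρ q <;> simp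

theorem equalityFree_toBounded (θ : NamedFormula L P) {n : ℕ} (ρ : P → L.Functions 0 ⊕ Fin n) :
    (θ.toBounded ρ).EqualityFree := by
  induction θ generalizing n with
  | bot => trivial
  | rel => trivial
  | imp _ _ h₁ h₂ => exact ⟨h₁ ρ, h₂ ρ⟩
  | all p θ ih => exact ih _

theorem sig_toBounded_subset (θ : NamedFormula L P) {n : ℕ} (ρ : P → L.Functions 0 ⊕ Fin n) :
    (θ.toBounded ρ).sig ⊆
      Sum.inr '' θ.rels ∪ {s | ∃ p c, ρ p = Sum.inl c ∧ s = Sum.inl ⟨0, c⟩} := by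
  classical
  induction θ generalizing n with
  | bot => exact empty_subset _
  | rel R ts =>
    refine insert_subset (Or.inl ⟨_, rfl, rfl⟩) (iUnion_subset fun i => ?_)
    intro s hs
    rcases h : ρ (ts i) with c | j
    · simp only [h, atomTerm, Term.sig, iUnion_of_empty] at hs
      exact Or.inr ⟨_, c, h, by simpa using hs⟩
    · simp [h, atomTerm, Term.sig] at hs
  | imp _ _ h₁ h₂ =>
    refine union_subset ((h₁ ρ).trans ?_) ((h₂ ρ).trans ?_) <;>
    refine union_subset_union_left _ (image_mono ?_)
    exacts [subset_union_left, subset_union_right]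
  | all p θ ih =>
    refine (ih _).trans (union_subset_union_right _ ?_)
    rintro s ⟨q, c, h, rfl⟩
    by_cases hq : q = p
    · subst hq; simp at h
    · rw [update_of_ne hq, comp_apply] at h
      rcases hρ : ρ q with d | j
      · rw [hρ] at h
        exact ⟨q, c, hρ.trans (congrArg _ (Sum.inl_injective h)), rfl⟩
      · rw [hρ] at h
        cases h

end NamedFormula

/-! ### Separability and its closure rules -/

namespace Interpolation

/-- A formula whose variables have been replaced by parameters, with the truth value it is meant
to have. -/
structure Signed (L : Language.{u, v}) (P : Type*) where
  arity : ℕ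
  formula : L.BoundedFormula Empty arity
  params : Fin arity → P
  sign : Prop

variable (k : (Σ n, L.Functions n) → P)

/-- The signed formula has its intended truth value. -/
def Signed.Correct (r : ∀ n, L.Relations n → (Fin n → M) → Prop) (e : P → M)
    (c : Signed L P) : Prop :=
  c.formula.Holds r (e ∘ k) (e ∘ c.params) ↔ c.sign

/-- All parameters of the signed formula belong to `A`. -/
def Signed.Over (A : Set P) (c : Signed L P) : Prop :=
  (∀ f, Sum.inl f ∈ c.formula.sig → k f ∈ A) ∧ ∀ i, c.params i ∈ A

variable {k}

theorem Signed.Over.mono {A B : Set P} (h : A ⊆ B) {c : Signed L P} (hc : c.Over k A) :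
    c.Over k B :=
  ⟨fun f hf => h (hc.1 f hf), fun i => h (hc.2 i)⟩

theorem Signed.Over.correct_congr {A : Set P} {c : Signed L P} (hc : c.Over k A)
    {r : ∀ n, L.Relations n → (Fin n → M) → Prop} {e e' : P → M} (h : EqOn e e' A) :
    c.Correct k r e ↔ c.Correct k r e' := by
  have hx : e ∘ c.params = e' ∘ c.params := funext fun i => h (hc.2 i)
  unfold Signed.Correct
  rw [hx, c.formula.holds_congr (k := e ∘ k) (k' := e' ∘ k) _ fun f hf => h (hc.1 f hf)]

/-- A set of available parameters with a set of signed formulas. -/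
structure Side (L : Language.{u, v}) (P : Type*) where
  vars : Set P
  fmls : Set (Signed L P)

variable (k) in
/-- `X` entails the named formula `θ`. -/
def Side.Entails (X : Side L P) (θ : NamedFormula L P) : Prop :=
  ∀ (M : Type (max u v)) (r : ∀ n, L.Relations n → (Fin n → M) → Prop) (e : P → M),
    (∀ c ∈ X.fmls, c.Correct k r e) → θ.Holds r e

variable (k) in
/-- `X` and `Y` are separated by a named formula over the relation symbols `C` and the common
parameters. -/
def Separable (C : Set (Σ n, L.Relations n)) (X Y : Side L P) : Prop :=
  ∃ θ : NamedFormula L P, θ.rels ⊆ C ∧ θ.free ⊆ X.vars ∩ Y.vars ∧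
    X.Entails k θ ∧ Y.Entails k (θ.imp .bot)

variable {C : Set (Σ n, L.Relations n)} {X Y : Side L P}

theorem Separable.symm (h : Separable k C X Y) : Separable k C Y X := by
  obtain ⟨θ, hC, hf, hX, hY⟩ := h
  refine ⟨θ.imp .bot, union_subset hC (empty_subset _),
    union_subset (hf.trans (inter_comm _ _).subset) (empty_subset _), hY, ?_⟩
  exact fun M r e he hn => hn (hX M r e he)

theorem separable_of_unsatisfiable
    (h : ∀ (M : Type (max u v)) (r : ∀ n, L.Relations n → (Fin n → M) → Prop) (e : P → M),
      ¬ ∀ c ∈ X.fmls, c.Correct k r e) : Separable k C X Y :=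
  ⟨.bot, empty_subset _, empty_subset _, fun M r e he => h M r e he, fun _ _ _ _ hn => hn⟩

/-- As `X` says nothing about `p`, it entails the generalization over `p` of whatever it entails. A
side may thus borrow parameters of the other side. -/
theorem Separable.of_insert_var {p : P} (hp : p ∉ X.vars) (hX : ∀ c ∈ X.fmls, c.Over k X.vars)
    (h : Separable k C ⟨insert p X.vars, X.fmls⟩ Y) : Separable k C X Y := by
  classical
  obtain ⟨θ, hC, hf, hθ, hY⟩ := h
  refine ⟨.all p θ, hC, ?_, ?_, ?_⟩
  · rintro q ⟨hq, hqp⟩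
    exact ⟨(hf hq).1.resolve_left hqp, (hf hq).2⟩
  · intro M r e he a
    refine hθ M r _ fun c hc => ((hX c hc).correct_congr fun q hq => ?_).2 (he c hc)
    exact update_of_ne (ne_of_mem_of_not_mem hq hp) _ _
  · intro M r e he hall
    refine hY M r e he ?_
    have := hall (e p)
    rwa [update_eq_self] at this

theorem Separable.of_union_vars {S : Set P} (hS : S.Finite)
    (hX : ∀ c ∈ X.fmls, c.Over k X.vars)
    (h : Separable k C ⟨S ∪ X.vars, X.fmls⟩ Y) : Separable k C X Y := by
  induction S, hS using Set.Finite.induction_on with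
  | empty => rwa [empty_union] at h
  | @insert p S _ _ ih =>
    refine ih ?_
    rw [insert_union] at h
    by_cases hp : p ∈ S ∪ X.vars
    · rwa [insert_eq_of_mem hp] at h
    · exact h.of_insert_var (X := ⟨S ∪ X.vars, X.fmls⟩) hp
        fun c hc => (hX c hc).mono subset_union_right

/-- The disjunction of the two separators, written as `¬θ → θ'`, separates the original pair. -/
theorem Separable.of_cut {n : ℕ} {χ : L.BoundedFormula Empty n} {x : Fin n → P}
    (h₁ : Separable k C ⟨X.vars, insert ⟨n, χ, x, True⟩ X.fmls⟩ Y)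
    (h₂ : Separable k C ⟨X.vars, insert ⟨n, χ, x, False⟩ X.fmls⟩ Y) : Separable k C X Y := by
  obtain ⟨θ, hC, hf, hX, hY⟩ := h₁
  obtain ⟨θ', hC', hf', hX', hY'⟩ := h₂
  refine ⟨.imp (.imp θ .bot) θ', union_subset (union_subset hC (empty_subset _)) hC',
    union_subset (union_subset hf (empty_subset _)) hf', ?_, ?_⟩
  · intro M r e he hn
    by_cases hχ : χ.Holds r (e ∘ k) (e ∘ x)
    · exact (hn (hX M r e (forall_mem_insert.2 ⟨iff_true_intro hχ, he⟩))).elim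
    · exact hX' M r e (forall_mem_insert.2 ⟨iff_false_intro hχ, he⟩)
  · exact fun M r e he hn => hY' M r e he (hn (hY M r e he))

/-- The parameter `p` is new to both sides, hence not free in the separator. In a model of `X` it
can be reinterpreted as a counterexample to `χ.all` without affecting anything else. -/
theorem Separable.of_witness {n : ℕ} {χ : L.BoundedFormula Empty (n + 1)} {x : Fin n → P} {p : P}
    (hpX : p ∉ X.vars) (hpY : p ∉ Y.vars) (hX : ∀ c ∈ X.fmls, c.Over k X.vars)
    (hχ : ⟨n, χ.all, x, False⟩ ∈ X.fmls)
    (h : Separable k C ⟨insert p X.vars, insert ⟨n + 1, χ, Fin.snoc x p, False⟩ X.fmls⟩ Y) :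
    Separable k C X Y := by
  classical
  obtain ⟨θ, hC, hf, hθ, hY⟩ := h
  have hpf : p ∉ θ.free := fun hp => hpY (hf hp).2
  refine ⟨θ, hC, fun q hq => ⟨(hf hq).1.resolve_left fun h => hpf (h ▸ hq), (hf hq).2⟩, ?_, hY⟩
  intro M r e he
  have hall : ¬ ∀ a, χ.Holds r (e ∘ k) (Fin.snoc (e ∘ x) a) := (he _ hχ).1
  push Not at hall
  obtain ⟨a, ha⟩ := hall
  have heq : EqOn (update e p a) e X.vars :=
    fun q hq => update_of_ne (ne_of_mem_of_not_mem hq hpX) _ _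
  rw [← θ.holds_congr (e := update e p a) fun q hq => update_of_ne (ne_of_mem_of_not_mem hq hpf) _ _]
  refine hθ M r _ (forall_mem_insert.2
    ⟨iff_false_intro ?_, fun c hc => ((hX c hc).correct_congr heq).2 (he c hc)⟩)
  have hO := hX _ hχ
  have h1 : update e p a ∘ Fin.snoc (α := fun _ => P) x p = Fin.snoc (α := fun _ => M) (e ∘ x) a := by
    rw [Fin.comp_snoc, update_self]
    congr 1
    exact funext fun i => heq (hO.2 i)
  rwa [h1, χ.holds_congr (k := update e p a ∘ k) (k' := e ∘ k) _ fun f hf => heq (hO.1 f hf)]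

/-! ### Enlarging inseparable pairs -/

variable (k C) in
/-- The invariant of the construction. -/
structure Inseparable (X Y : Side L P) : Prop where
  left : ∀ c ∈ X.fmls, c.Over k X.vars
  right : ∀ c ∈ Y.fmls, c.Over k Y.vars
  infinite : (X.vars ∪ Y.vars)ᶜ.Infinite
  not_separable : ¬ Separable k C X Y

theorem Inseparable.symm (h : Inseparable k C X Y) : Inseparable k C Y X :=
  ⟨h.right, h.left, union_comm X.vars _ ▸ h.infinite, fun hs => h.not_separable hs.symm⟩

/-- The formula `χ` with parameters `x` is decided by `G`, and has a witness if it is a universal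
formula decided negatively. -/
def Decides (G : Set (Signed L P)) {n : ℕ} (χ : L.BoundedFormula Empty n) (x : Fin n → P) : Prop :=
  ⟨n, χ, x, True⟩ ∈ G ∨ ⟨n, χ, x, False⟩ ∈ G ∧
    ∀ χ', χ = .all χ' → ∃ p, ⟨n + 1, χ', Fin.snoc x p, False⟩ ∈ G

theorem Inseparable.exists_decides (h : Inseparable k C X Y) {n : ℕ}
    (χ : L.BoundedFormula Empty n) (x : Fin n → P)
    (hχ : ∀ f, Sum.inl f ∈ χ.sig → k f ∈ X.vars) :
    ∃ X' : Side L P, X.vars ⊆ X'.vars ∧ X.fmls ⊆ X'.fmls ∧ Inseparable k C X' Y ∧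
      Decides X'.fmls χ x := by
  have hfin : (range x).Finite := finite_range x
  set A := range x ∪ X.vars with hA
  have hXA : X.vars ⊆ A := subset_union_right
  have hOv : ∀ s, (⟨n, χ, x, s⟩ : Signed L P).Over k A := fun s =>
    ⟨fun f hf => hXA (hχ f hf), fun i => Or.inl (mem_range_self i)⟩
  -- Only finitely many parameters are added to `X`, so infinitely many remain fresh for later
  -- witnesses.
  have hOX : ∀ c ∈ X.fmls, c.Over k A := fun c hc => (h.left c hc).mono hXA
  have hinf : (A ∪ Y.vars)ᶜ.Infinite := by
    rw [hA, union_assoc, compl_union, inter_comm]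
    exact h.infinite.sdiff hfin
  have h0 : ¬ Separable k C ⟨A, X.fmls⟩ Y := fun hs =>
    h.not_separable (hs.of_union_vars hfin h.left)
  by_cases h1 : Separable k C ⟨A, insert ⟨n, χ, x, True⟩ X.fmls⟩ Y
  · have h2 : ¬ Separable k C ⟨A, insert ⟨n, χ, x, False⟩ X.fmls⟩ Y := fun h2 =>
      h0 (Separable.of_cut (X := ⟨A, X.fmls⟩) h1 h2)
    have hO2 : ∀ c ∈ insert ⟨n, χ, x, False⟩ X.fmls, c.Over k A :=
      forall_mem_insert.2 ⟨hOv _, hOX⟩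
    by_cases hall : ∃ χ', χ = .all χ'
    · obtain ⟨χ', rfl⟩ := hall
      obtain ⟨p, hp⟩ := hinf.nonempty
      rw [mem_compl_iff, mem_union, not_or] at hp
      refine ⟨⟨insert p A, insert ⟨n + 1, χ', Fin.snoc x p, False⟩
        (insert ⟨n, χ'.all, x, False⟩ X.fmls)⟩, hXA.trans (subset_insert _ _),
        (subset_insert _ _).trans (subset_insert _ _), ⟨?_, h.right, ?_, ?_⟩, Or.inr ⟨?_, ?_⟩⟩
      · refine forall_mem_insert.2 ⟨⟨fun f hf => Or.inr ((hOv True).1 f hf), fun i => ?_⟩,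
          fun c hc => (hO2 c hc).mono (subset_insert _ _)⟩
        refine Fin.lastCases ?_ (fun i => ?_) i
        · simp
        · simpa using Or.inr ((hOv True).2 i)
      · refine (hinf.sdiff (finite_singleton p)).mono ?_
        rintro q ⟨hq, hqp⟩ (hq' | hq')
        · rcases hq' with rfl | hq'
          exacts [hqp rfl, hq (Or.inl hq')]
        · exact hq (Or.inr hq')
      · exact fun hs => h2 (Separable.of_witness (X := ⟨A, _⟩) hp.1 hp.2 hO2 (mem_insert _ _) hs)
      · exact mem_insert_of_mem _ (mem_insert _ _)
      · intro χ'' he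
        cases he
        exact ⟨p, mem_insert _ _⟩
    · exact ⟨⟨A, insert ⟨n, χ, x, False⟩ X.fmls⟩, hXA, subset_insert _ _,
        ⟨hO2, h.right, hinf, h2⟩, Or.inr ⟨mem_insert _ _, fun χ' he => (hall ⟨χ', he⟩).elim⟩⟩
  · exact ⟨⟨A, insert ⟨n, χ, x, True⟩ X.fmls⟩, hXA, subset_insert _ _,
      ⟨forall_mem_insert.2 ⟨hOv _, hOX⟩, h.right, hinf, h1⟩, Or.inl (mem_insert _ _)⟩

variable (k C) in
/-- Each of the sets `Γ b` decides all instances of subformulas of `F b`, and every finite part of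
the pair extends to an inseparable pair. -/
structure IsHintikka (F : Bool → L.Sentence) (Γ : Bool → Set (Signed L P)) : Prop where
  decides : ∀ b n (χ : L.BoundedFormula Empty n), ⟨n, χ⟩ ∈ (F b).subformulas → ∀ x,
    Decides (Γ b) χ x
  finite_inseparable : ∀ s : Set (Bool × Signed L P), s.Finite → (∀ q ∈ s, q.2 ∈ Γ q.1) →
    ∃ S : Bool → Side L P, (∀ b, Inseparable k C (S b) (S !b)) ∧ ∀ q ∈ s, q.2 ∈ (S q.1).fmls

theorem exists_decides_step {S : Bool → Side L P} (hS : ∀ b, Inseparable k C (S b) (S !b))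
    (b : Bool) {n : ℕ} (χ : L.BoundedFormula Empty n) (x : Fin n → P)
    (hχ : ∀ f, Sum.inl f ∈ χ.sig → k f ∈ (S b).vars) :
    ∃ S' : Bool → Side L P, (∀ b, (S b).vars ⊆ (S' b).vars ∧ (S b).fmls ⊆ (S' b).fmls) ∧
      (∀ b, Inseparable k C (S' b) (S' !b)) ∧ Decides (S' b).fmls χ x := by
  obtain ⟨X', hv, hf, hX', hd⟩ := (hS b).exists_decides χ x hχ
  refine ⟨update S b X', fun b' => ?_, fun b' => ?_, by simpa using hd⟩
  · by_cases h : b' = b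
    · subst h; simp [hv, hf]
    · simp [h]
  · cases b <;> cases b' <;> first | exact hX' | exact hX'.symm

/-- Each stage settles one task from a countable list; one visit suffices because decisions persist.
The limit itself need not be inseparable, but a finite part of it already lies in some stage, and
only finite parts are ever used. -/
theorem exists_isHintikka [Countable P] {F : Bool → L.Sentence} {S : Bool → Side L P}
    (hS : ∀ b, Inseparable k C (S b) (S !b))
    (hk : ∀ b f, Sum.inl f ∈ (F b).sig → k f ∈ (S b).vars) :
    ∃ Γ, (∀ b, (S b).fmls ⊆ Γ b) ∧ IsHintikka k C F Γ := by
  have hcount : ∀ b, Countable (F b).subformulas := fun b =>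
    (F b).countable_subformulas.to_subtype
  let T := Σ b : Bool, Σ χ : (F b).subformulas, (Fin χ.1.1 → P)
  have : Nonempty T := ⟨⟨true, ⟨_, (F true).self_mem_subformulas⟩, Fin.elim0⟩⟩
  obtain ⟨task, htask⟩ := exists_surjective_nat T
  let Stage := {S : Bool → Side L P // (∀ b, Inseparable k C (S b) (S !b)) ∧
    ∀ b f, Sum.inl f ∈ (F b).sig → k f ∈ (S b).vars}
  have step : ∀ (S : Stage) (t : T), ∃ S' : Stage, (∀ b, (S.1 b).fmls ⊆ (S'.1 b).fmls) ∧
      Decides (S'.1 t.1).fmls t.2.1.1.2 t.2.2 := by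
    rintro ⟨S, hS, hk⟩ ⟨b, ⟨⟨n, χ⟩, hχ⟩, x⟩
    obtain ⟨S', hsub, hS', hd⟩ := exists_decides_step hS b χ x fun f hf =>
      hk b f (BoundedFormula.sig_subset_of_mem_subformulas hχ hf)
    exact ⟨⟨S', hS', fun b f hf => (hsub b).1 (hk b f hf)⟩, fun b => (hsub b).2, hd⟩
  choose next hsub hdec using step
  let seq : ℕ → Stage := fun m => Nat.rec ⟨S, hS, hk⟩ (fun m S => next S (task m)) m
  have hmono : ∀ b, Monotone fun m => ((seq m).1 b).fmls := fun b =>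
    monotone_nat_of_le_succ fun m => hsub (seq m) (task m) b
  refine ⟨fun b => ⋃ m, ((seq m).1 b).fmls, fun b => subset_iUnion_of_subset 0 Subset.rfl,
    ⟨fun b n χ hχ x => ?_, fun s hs hsΓ => ?_⟩⟩
  · obtain ⟨m, hm⟩ := htask ⟨b, ⟨⟨n, χ⟩, hχ⟩, x⟩
    have hd := hdec (seq m) (task m)
    rw [hm] at hd
    have hle : ((next (seq m) ⟨b, ⟨⟨n, χ⟩, hχ⟩, x⟩).1 b).fmls ⊆ ⋃ m, ((seq m).1 b).fmls := by
      rw [← hm]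
      exact subset_iUnion (fun m => ((seq m).1 b).fmls) (m + 1)
    refine hd.imp (fun h => hle h) fun h => ⟨hle h.1, fun χ' hχ' => ?_⟩
    obtain ⟨p, hp⟩ := h.2 χ' hχ'
    exact ⟨p, hle hp⟩
  · have : ∃ m, ∀ q ∈ s, q.2 ∈ ((seq m).1 q.1).fmls := by
      induction s, hs using Set.Finite.induction_on with
      | empty => exact ⟨0, by simp⟩
      | @insert q s _ _ ih =>
        obtain ⟨m, hm⟩ := ih fun q hq => hsΓ q (mem_insert_of_mem _ hq)
        obtain ⟨m', hm'⟩ := mem_iUnion.1 (hsΓ q (mem_insert _ _))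
        refine ⟨max m m', forall_mem_insert.2 ⟨hmono _ (le_max_right m m') hm', fun q hq => ?_⟩⟩
        exact hmono _ (le_max_left m m') (hm q hq)
    obtain ⟨m, hm⟩ := this
    exact ⟨(seq m).1, (seq m).2.1, hm⟩

/-! ### The truth lemma for the term model -/

section Truth

variable {F : Bool → L.Sentence} {Γ : Bool → Set (Signed L P)}

/-- An unsatisfiable side would be separated from the other by `⊥`. This supplies all the
consistency needed in the truth lemma, semantically and without a proof calculus. -/
theorem IsHintikka.exists_correct (h : IsHintikka k C F Γ) (b : Bool) {s : Set (Signed L P)}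
    (hs : s.Finite) (hsΓ : s ⊆ Γ b) :
    ∃ (M : Type (max u v)) (r : ∀ n, L.Relations n → (Fin n → M) → Prop) (e : P → M),
      ∀ c ∈ s, c.Correct k r e := by
  obtain ⟨S, hS, hsS⟩ := h.finite_inseparable (Prod.mk b '' s) (hs.image _)
    (forall_mem_image.2 fun c hc => hsΓ hc)
  by_contra! hn
  refine (hS b).not_separable (separable_of_unsatisfiable fun M r e he => ?_)
  obtain ⟨c, hc, hce⟩ := hn M r e
  exact hce (he c (hsS _ (mem_image_of_mem _ hc)))

variable (k F Γ) in
/-- The interpretation of the relation symbols in the term model. -/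
def termRel (n : ℕ) (R : L.Relations n) (ts : Fin n → P) : Prop :=
  ∃ b m, ∃ ss : Fin n → L.Term (Empty ⊕ Fin m), ∃ x : Fin m → P,
    ⟨m, .rel R ss, x, True⟩ ∈ Γ b ∧ ⟨m, .rel R ss⟩ ∈ (F b).subformulas ∧
      ts = fun i => (ss i).value k x

theorem IsHintikka.not_termRel (h : IsHintikka k C F Γ)
    (hC : ∀ R, (∀ b, Sum.inr R ∈ (F b).sig) → R ∈ C) {b : Bool} {n m : ℕ} {R : L.Relations n}
    {ss : Fin n → L.Term (Empty ⊕ Fin m)} {x : Fin m → P}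
    (hF : ⟨m, .rel R ss⟩ ∈ (F b).subformulas) (hΓ : ⟨m, .rel R ss, x, False⟩ ∈ Γ b) :
    ¬ termRel k F Γ n R fun i => (ss i).value k x := by
  rintro ⟨b', m', ss', x', hΓ', hF', hss⟩
  have hval : ∀ {M : Type (max u v)} {r : ∀ n, L.Relations n → (Fin n → M) → Prop} {e : P → M},
      (Signed.Correct k r e ⟨m, .rel R ss, x, False⟩ →
        ¬ r n R (e ∘ fun i => (ss i).value k x)) ∧
      (Signed.Correct k r e ⟨m', .rel R ss', x', True⟩ →
        r n R (e ∘ fun i => (ss i).value k x)) := by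
    intro M r e
    rw [hss]
    have : e ∘ (fun i => (ss i).value k x) = e ∘ fun i => (ss' i).value k x' := by rw [hss]
    rw [← this]
    simp only [Signed.Correct, BoundedFormula.Holds, Term.value_comp, iff_true, iff_false]
    refine ⟨id, fun h => ?_⟩
    rwa [this]
  obtain rfl | rfl : b' = b ∨ b' = !b := by cases b <;> cases b' <;> simp
  -- Both signs on the same side contradict satisfiability of finite parts.
  · obtain ⟨M, r, e, he⟩ := h.exists_correct b' (s := {_, _}) (toFinite _)
      (insert_subset hΓ (singleton_subset_iff.2 hΓ'))
    exact hval.1 (he _ (by simp)) (hval.2 (he _ (by simp)))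
  · obtain ⟨S, hS, hsS⟩ := h.finite_inseparable
      {(b, ⟨m, .rel R ss, x, False⟩), (!b, ⟨m', .rel R ss', x', True⟩)} (toFinite _)
      (by simp [hΓ, hΓ'])
    have h₁ := hsS (b, ⟨m, .rel R ss, x, False⟩) (by simp)
    have h₂ := hsS (!b, ⟨m', .rel R ss', x', True⟩) (by simp)
    have hO₁ := (hS b).left _ h₁
    have hO₂ := (hS b).right _ h₂
    -- On opposite sides the atom is a separator: `R` occurs in both sentences, and its arguments,
    -- having the same values on both sides, are common parameters.
    refine (hS b).not_separable (Separable.symm ⟨.rel R fun i => (ss i).value k x, ?_, ?_, ?_, ?_⟩)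
    · refine singleton_subset_iff.2 (hC _ fun b' => ?_)
      obtain rfl | rfl : b' = b ∨ b' = !b := by cases b <;> cases b' <;> simp
      exacts [BoundedFormula.sig_subset_of_mem_subformulas hF (mem_insert _ _),
        BoundedFormula.sig_subset_of_mem_subformulas hF' (mem_insert _ _)]
    · rintro _ ⟨i, rfl⟩
      refine ⟨?_, ?_⟩
      · rw [hss]
        exact Term.value_mem
          (fun f hf => hO₂.1 f (mem_insert_of_mem _ (mem_iUnion_of_mem i hf))) hO₂.2
      · exact Term.value_mem
          (fun f hf => hO₁.1 f (mem_insert_of_mem _ (mem_iUnion_of_mem i hf))) hO₁.2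
    · exact fun M r e he => hval.2 (he _ h₂)
    · exact fun M r e he => hval.1 (he _ h₁)

theorem IsHintikka.holds_termRel (h : IsHintikka k C F Γ)
    (hC : ∀ R, (∀ b, Sum.inr R ∈ (F b).sig) → R ∈ C) {b : Bool} {n : ℕ}
    {χ : L.BoundedFormula Empty n} (hχ : ⟨n, χ⟩ ∈ (F b).subformulas) (x : Fin n → P) :
    (⟨n, χ, x, True⟩ ∈ Γ b → χ.Holds (termRel k F Γ) k x) ∧
      (⟨n, χ, x, False⟩ ∈ Γ b → ¬ χ.Holds (termRel k F Γ) k x) := by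
  induction χ with
  | falsum =>
    refine ⟨fun ht => ?_, fun _ => id⟩
    obtain ⟨M, r, e, he⟩ := h.exists_correct b (finite_singleton _) (singleton_subset_iff.2 ht)
    exact (he _ rfl).2 trivial
  | equal =>
    refine ⟨fun ht => ?_, fun _ => id⟩
    obtain ⟨M, r, e, he⟩ := h.exists_correct b (finite_singleton _) (singleton_subset_iff.2 ht)
    exact (he _ rfl).2 trivial
  | rel R ss => exact ⟨fun ht => ⟨b, _, ss, x, ht, hχ, rfl⟩, h.not_termRel hC hχ⟩
  | imp χ₁ χ₂ ih₁ ih₂ =>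
    have hsub := BoundedFormula.subformulas_subset_of_mem hχ
    have hχ₁ := hsub (mem_insert_of_mem _ (Or.inl χ₁.self_mem_subformulas))
    have hχ₂ := hsub (mem_insert_of_mem _ (Or.inr χ₂.self_mem_subformulas))
    have d₁ := (h.decides b _ χ₁ hχ₁ x).imp_right And.left
    have d₂ := (h.decides b _ χ₂ hχ₂ x).imp_right And.left
    refine ⟨fun ht h₁ => ?_, fun ht => ?_⟩
    · refine d₂.elim (ih₂ hχ₂ x).1 fun hf₂ => ?_
      have ht₁ := d₁.resolve_right fun hf₁ => (ih₁ hχ₁ x).2 hf₁ h₁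
      obtain ⟨M, r, e, he⟩ := h.exists_correct b (s := {_, _, _}) (toFinite _)
        (insert_subset ht (insert_subset ht₁ (singleton_subset_iff.2 hf₂)))
      have e₀ := (he _ (mem_insert _ _)).2 trivial
      have e₁ := (he _ (mem_insert_of_mem _ (mem_insert _ _))).2 trivial
      exact ((he _ (mem_insert_of_mem _ (mem_insert_of_mem _ rfl))).1 (e₀ e₁)).elim
    · have ht₁ := d₁.resolve_right fun hf₁ => by
        obtain ⟨M, r, e, he⟩ := h.exists_correct b (s := {_, _}) (toFinite _)
          (insert_subset ht (singleton_subset_iff.2 hf₁))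
        exact (he _ (mem_insert _ _)).1 fun e₁ => ((he _ (mem_insert_of_mem _ rfl)).1 e₁).elim
      have hf₂ := d₂.resolve_left fun ht₂ => by
        obtain ⟨M, r, e, he⟩ := h.exists_correct b (s := {_, _}) (toFinite _)
          (insert_subset ht (singleton_subset_iff.2 ht₂))
        exact (he _ (mem_insert _ _)).1 fun _ => (he _ (mem_insert_of_mem _ rfl)).2 trivial
      exact fun himp => (ih₂ hχ₂ x).2 hf₂ (himp ((ih₁ hχ₁ x).1 ht₁))
  | @all n χ ih =>
    have hχ' := BoundedFormula.subformulas_subset_of_mem hχ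
      (mem_insert_of_mem _ χ.self_mem_subformulas)
    refine ⟨fun ht a => ?_, fun hf hall => ?_⟩
    · refine ((h.decides b _ χ hχ' (Fin.snoc x a)).imp_right And.left).elim (ih hχ' _).1
        fun hf => ?_
      obtain ⟨M, r, e, he⟩ := h.exists_correct b (s := {_, _}) (toFinite _)
        (insert_subset ht (singleton_subset_iff.2 hf))
      refine ((he _ (mem_insert_of_mem _ rfl)).1 ?_).elim
      have := (he _ (mem_insert _ _)).2 trivial (e a)
      rwa [← Fin.comp_snoc] at this
    -- A negative signed formula alone gives no witness; the witness comes from `Decides`, whose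
    -- positive alternative is inconsistent with `hf`.
    · rcases h.decides b _ χ.all hχ x with ht | ⟨-, hw⟩
      · obtain ⟨M, r, e, he⟩ := h.exists_correct b (s := {_, _}) (toFinite _)
          (insert_subset ht (singleton_subset_iff.2 hf))
        exact (he _ (mem_insert_of_mem _ rfl)).1 ((he _ (mem_insert _ _)).2 trivial)
      · obtain ⟨p, hp⟩ := hw χ rfl
        exact (ih hχ' _).2 hp (hall p)

end Truth

/-! ### Inseparable sentences have a common model -/

variable (k) in
/-- The side consisting of a sentence and the function symbols occurring in it. -/
def initialSide (φ : L.Sentence) : Side L P :=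
  ⟨{p | ∃ f, Sum.inl f ∈ φ.sig ∧ k f = p}, {⟨0, φ, Fin.elim0, True⟩}⟩

theorem separable_initialSide [Countable P] {φ ψ : L.Sentence}
    (hφ_fun : φ.FunctionFree) (hφ_eq : φ.EqualityFree)
    (hψ_fun : ψ.FunctionFree) (hψ_eq : ψ.EqualityFree)
    (hunsat : ¬ ({φ, ψ} : L.Theory).IsSatisfiable)
    (hinf : {p | ∀ f, Sum.inl f ∈ φ.sig ∪ ψ.sig → k f ≠ p}.Infinite)
    (hC : ∀ R, Sum.inr R ∈ φ.sig ∩ ψ.sig → R ∈ C) :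
    Separable k C (initialSide k φ) (initialSide k ψ) := by
  by_contra hsep
  apply hunsat
  have hOver : ∀ χ : L.Sentence, ∀ c ∈ (initialSide k χ).fmls,
      c.Over k (initialSide k χ).vars := by
    rintro χ _ rfl
    exact ⟨fun f hf => ⟨f, hf, rfl⟩, fun i => i.elim0⟩
  have hI : Inseparable k C (initialSide k φ) (initialSide k ψ) := by
    refine ⟨hOver φ, hOver ψ, hinf.mono fun p hp => ?_, hsep⟩
    rintro (⟨f, hf, hfp⟩ | ⟨f, hf, hfp⟩)
    exacts [hp f (Or.inl hf) hfp, hp f (Or.inr hf) hfp]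
  let F : Bool → L.Sentence := fun b => cond b φ ψ
  obtain ⟨Γ, h0, hΓ⟩ := exists_isHintikka (F := F) (S := fun b => initialSide k (F b))
    (by rintro (_ | _); exacts [hI.symm, hI]) fun b f hf => ⟨f, hf, rfl⟩
  have holds : ∀ b, (F b).Holds (termRel k F Γ) k Fin.elim0 := fun b =>
    (hΓ.holds_termRel (fun R hR => hC R ⟨hR true, hR false⟩) (F b).self_mem_subformulas _).1
      (h0 b rfl)
  have : Nonempty P := hinf.nonempty.to_type
  let _ : L.Structure P := ⟨fun f _ => k ⟨_, f⟩, fun {n} => termRel k F Γ n⟩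
  have hreal : ∀ b, (F b).FunctionFree → (F b).EqualityFree → P ⊨ F b := fun b hf he =>
    ((F b).realize_iff_holds (k := k) default default hf he fun _ _ => rfl).2
      (Subsingleton.elim Fin.elim0 (default : Fin 0 → P) ▸ holds b)
  have : P ⊨ ({φ, ψ} : L.Theory) := by
    rw [Theory.model_iff]
    rintro χ (rfl | rfl)
    exacts [hreal true hφ_fun hφ_eq, hreal false hψ_fun hψ_eq]
  exact Theory.Model.isSatisfiable P

end Interpolation

end FirstOrder.Language


/-! ### From the separator to the interpolant -/

theorem mainTheorem1 (L : FirstOrder.Language.{u, v}) (φ ψ : L.Sentence)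
    (hφ_fun : φ.FunctionFree) (hφ_eq : φ.EqualityFree)
    (hψ_fun : ψ.FunctionFree) (hψ_eq : ψ.EqualityFree)
    (hunsat : ¬ ({φ, ψ} : L.Theory).IsSatisfiable) :
    ∃ θ : L.Sentence, θ.FunctionFree ∧ θ.EqualityFree ∧
      (∅ : L.Theory) ⊨ᵇ φ.imp θ ∧
      (∅ : L.Theory) ⊨ᵇ ψ.imp θ.not ∧
      θ.sig ⊆ φ.sig ∩ ψ.sig := by
  classical
  let K := {f : Σ n, L.Functions n // Sum.inl f ∈ φ.sig ∪ ψ.sig}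
  have : Countable K :=
    (φ.countable_functions_sig.union ψ.countable_functions_sig).to_subtype
  -- Distinct symbols of the two sentences get distinct parameters; the summand `ℕ` supplies fresh
  -- witnesses. Symbols outside both sentences get the irrelevant value `.inr 0`.
  let k : (Σ n, L.Functions n) → K ⊕ ℕ := fun f =>
    if h : Sum.inl f ∈ φ.sig ∪ ψ.sig then .inl ⟨f, h⟩ else .inr 0
  have hk : ∀ f (h : Sum.inl f ∈ φ.sig ∪ ψ.sig), k f = .inl ⟨f, h⟩ := fun f h => dif_pos h
  obtain ⟨θ, hθC, hθf, hφθ, hψθ⟩ := FirstOrder.Language.Interpolation.separable_initialSide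
    (k := k) (C := {R | Sum.inr R ∈ φ.sig ∩ ψ.sig}) hφ_fun hφ_eq hψ_fun hψ_eq hunsat
    (by
      refine (Set.infinite_range_of_injective (Sum.inr_injective (α := K) (β := ℕ))).mono ?_
      rintro _ ⟨m, rfl⟩ f hf h
      simp [hk f hf] at h)
    fun R hR => hR
  -- Common constants stand for themselves. All other parameters go to a single dummy variable,
  -- later bound by an outer quantifier, since the language may have no constant to use instead.
  let ρ : K ⊕ ℕ → L.Functions 0 ⊕ Fin 1 := fun p =>
    match p with
    | .inl ⟨⟨0, c⟩, _⟩ => if Sum.inl ⟨0, c⟩ ∈ φ.sig ∩ ψ.sig then .inl c else .inr 0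
    | _ => .inr 0
  have hρ : ∀ p c, ρ p = .inl c → Sum.inl ⟨0, c⟩ ∈ φ.sig ∩ ψ.sig := by
    rintro (⟨⟨_ | l, f⟩, hf⟩ | m) c h
    · by_cases hc : Sum.inl ⟨0, f⟩ ∈ φ.sig ∩ ψ.sig
      · rwa [← Sum.inl_injective ((if_pos hc).symm.trans h)]
      · exact absurd ((if_neg hc).symm.trans h) Sum.inr_ne_inl
    · simp [ρ] at h
    · simp [ρ] at h
  have hsig : (θ.toBounded ρ).all.sig ⊆ φ.sig ∩ ψ.sig := by
    refine (θ.sig_toBounded_subset ρ).trans (Set.union_subset ?_ ?_)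
    · rintro _ ⟨R, hR, rfl⟩
      exact hθC hR
    · rintro _ ⟨p, c, h, rfl⟩
      exact hρ p c h
  have key : ∀ (M : Type (max u v)) [L.Structure M] (x : Fin 1 → M), ∃ e : K ⊕ ℕ → M,
      (∀ χ ∈ ({φ, ψ} : Set L.Sentence), χ.FunctionFree → χ.EqualityFree →
        ∀ (w : Empty → M) (y : Fin 0 → M), FirstOrder.Language.BoundedFormula.Realize χ w y → ∀ c ∈
          (FirstOrder.Language.Interpolation.initialSide k χ).fmls,
            c.Correct k (fun _ => FirstOrder.Language.Structure.RelMap) e) ∧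
      ∀ w : Empty → M, (θ.toBounded ρ).Realize w x ↔
        θ.Holds (fun _ => FirstOrder.Language.Structure.RelMap) e := by
    intro M _ x
    refine ⟨fun p => match p with
      | .inl ⟨⟨0, c⟩, _⟩ => FirstOrder.Language.Structure.funMap c default
      | _ => x 0, ?_, fun w => ?_⟩
    · rintro χ hχ hf he w y hr _ rfl
      refine iff_true_intro ?_
      rw [Subsingleton.elim ((_ : K ⊕ ℕ → M) ∘ _) y]
      refine (χ.realize_iff_holds w y hf he fun c hc => ?_).1 hr
      have : Sum.inl ⟨0, c⟩ ∈ φ.sig ∪ ψ.sig := by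
        rcases hχ with rfl | rfl
        exacts [Or.inl hc, Or.inr hc]
      simp [hk _ this]
    -- The two assignments agree on the free variables of `θ`, which are parameters of common
    -- constants: injectivity of `k` on occurring symbols makes a shared parameter come from one
    -- shared symbol.
    · refine (θ.realize_toBounded ρ w x).trans (θ.holds_congr fun p hp => ?_)
      obtain ⟨⟨f, hf, hfp⟩, ⟨g, hg, hgp⟩⟩ := hθf hp
      rw [hk f (Or.inl hf)] at hfp
      rw [hk g (Or.inr hg), ← hfp] at hgp
      obtain rfl : g = f := congrArg Subtype.val (Sum.inl_injective hgp)
      obtain ⟨l, c⟩ := g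
      obtain rfl := hφ_fun l c hf
      have hc : Sum.inl ⟨0, c⟩ ∈ φ.sig ∩ ψ.sig := ⟨hf, hg⟩
      subst hfp
      exact congrArg (Sum.elim (fun c => FirstOrder.Language.Structure.funMap c default) x)
        (if_pos hc)
  refine ⟨(θ.toBounded ρ).all, fun l f hf => hφ_fun l f (hsig hf).1,
    θ.equalityFree_toBounded ρ, ?_, ?_, hsig⟩
  · intro M w y hr a
    obtain ⟨e, he, hθ⟩ := key M (Fin.snoc y a)
    exact (hθ w).2 (hφθ M _ e (he φ (Or.inl rfl) hφ_fun hφ_eq w y hr))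
  · intro M w y hr hall
    -- Nonemptiness of the domain allows the dummy quantifier to be instantiated.
    obtain ⟨a⟩ := M.nonempty'
    obtain ⟨e, he, hθ⟩ := key M (Fin.snoc y a)
    exact hψθ M _ e (he ψ (Or.inr rfl) hψ_fun hψ_eq w y hr) ((hθ w).1 (hall a))
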